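/- Let $A$ be a (not necessarily unital) C$^*$-algebra, let $\rho$ be a state on $A$, and let $\omega$ be a free ultrafilter on $\mathbb{N}$. Let $\ell_\infty(A)$ be the C$^*$-algebra of bounded sequences in $A$, and let $\Delta\colon A\to\ell_\infty(A)$, $\Delta(a)=(a,a,\ldots)$. Put $$L_\rho=\{(a_1,a_2,\ldots)\in\ell_\infty(A):\ \lim_{n\to\omega}\rho(a_n^*a_n)=0\},\qquad D_\rho=L_\rho\cap L_\rho^*,$$ $$\mathcal N(D_\rho)=\{x\in\ell_\infty(A):\ xD_\rho+D_\rho x\subset D_\rho\}.$$ Let $A^{**}$ be the second conjugate of $A$ (with its canonical product and involution extending those of $A\subset A^{**}$), and let $\overline\rho$ be the unique extension of $\rho$ to a normal (weak$^*$-continuous) state on $A^{**}$. Let $\ell_\infty(A^{**})$ be the space of bounded sequences in $A^{**}$. Then the following five conditions are equivalent: (i) $(a_1b,a_2b,\ldots)\in L_\rho$ for all $b\in A$ and all $(a_1,a_2,\ldots)\in L_\rho$. (ii) $\Delta(A)\subset\mathcal N(D_\rho)$. (iii) $\lim_{n\to\omega}\overline\rho(b^*a_n^*a_nb)=0$ for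 all $b\in A$ and all $(a_1,a_2,\ldots)\in\ell_\infty(A^{**})$ with $\lim_{n\to\omega}\overline\rho(a_n^*a_n)=0$. (iv) $\lim_{n\to\omega}\overline\rho(b^*a_n^*a_nb)=0$ for all $b\in A^{**}$ and all $(a_1,a_2,\ldots)\in\ell_\infty(A^{**})$ with $\lim_{n\to\omega}\overline\rho(a_n^*a_n)=0$. (v) The support projection of $\rho$ in $A^{**}$, that is, the smallest projection $p\in A^{**}$ with $\overline\rho(p)=1$, lies in the center of $A^{**}$. -/

import Mathlib

open Filter Topology
open scoped ENNReal ComplexOrder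

noncomputable section

/-- A state on a (not necessarily unital) C⋆-algebra: a positive linear functional of norm one. -/
structure IsState {A : Type*} [NonUnitalCStarAlgebra A] (ρ : StrongDual ℂ A) : Prop where
  nonneg : ∀ a : A, 0 ≤ ρ (star a * a)
  norm_eq_one : ‖ρ‖ = 1

/-- `ℓ_∞(E)`: the bounded sequences in `E`, with the supremum norm. -/
abbrev EllInfty (E : Type*) [NormedAddCommGroup E] : Type _ := lp (fun _ : ℕ => E) ∞

/-! ### The second conjugate of a C⋆-algebra -/

/-- The second conjugate `A**`: the Banach space bidual of `A`.  Below it gets the Arens product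
and the involution that extend those of `A`. -/
def SecondConj (A : Type*) [NonUnitalCStarAlgebra A] : Type _ := StrongDual ℂ (StrongDual ℂ A)

namespace SecondConj

variable {A : Type*} [NonUnitalCStarAlgebra A]

instance : NormedAddCommGroup (SecondConj A) :=
  inferInstanceAs (NormedAddCommGroup (StrongDual ℂ (StrongDual ℂ A)))

instance : NormedSpace ℂ (SecondConj A) :=
  inferInstanceAs (NormedSpace ℂ (StrongDual ℂ (StrongDual ℂ A)))

instance : FunLike (SecondConj A) (StrongDual ℂ A) ℂ :=
  inferInstanceAs (FunLike (StrongDual ℂ (StrongDual ℂ A)) (StrongDual ℂ A) ℂ)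

/-- The canonical embedding of `A` into `A**`, `ι a f = f a`. -/
def ι : A →L[ℂ] SecondConj A := NormedSpace.inclusionInDoubleDual ℂ A

@[simp] theorem ι_apply (a : A) (f : StrongDual ℂ A) : ι a f = f a := rfl

@[ext] theorem ext {F G : SecondConj A} (h : ∀ f : StrongDual ℂ A, F f = G f) : F = G :=
  ContinuousLinearMap.ext (f := (F : StrongDual ℂ (StrongDual ℂ A))) h

/-- The functional `G · f` on `A`, for `G` in `A**` and `f` in `A*`: it maps `a` to `G (f · a)`,
where `(f · a) b = f (a * b)`. -/
def act (G : SecondConj A) : StrongDual ℂ A →L[ℂ] StrongDual ℂ A :=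
  (ContinuousLinearMap.compL ℂ A (StrongDual ℂ A) ℂ (G : StrongDual ℂ (StrongDual ℂ A))).comp
    ((ContinuousLinearMap.compL ℂ A (A →L[ℂ] A) (StrongDual ℂ A)).flip
      (ContinuousLinearMap.mul ℂ A) |>.comp (ContinuousLinearMap.compL ℂ A A ℂ))

theorem act_apply (G : SecondConj A) (f : StrongDual ℂ A) (a : A) :
    act G f a = G (f.comp (ContinuousLinearMap.mul ℂ A a)) := rfl

/-- The Arens product on `A**`: `(F * G) f = F (G · f)`. -/
instance : Mul (SecondConj A) :=
  ⟨fun F G => ContinuousLinearMap.comp (F : StrongDual ℂ (StrongDual ℂ A)) (act G)⟩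

theorem mul_apply (F G : SecondConj A) (f : StrongDual ℂ A) : (F * G) f = F (act G f) := rfl

/-- The adjoint functional `f^*` on `A`: `f^* a = conj (f (a^*))`. -/
def adj (f : StrongDual ℂ A) : StrongDual ℂ A where
  toFun a := star (f (star a))
  map_add' a b := by simp
  map_smul' c a := by simp
  cont := by fun_prop

@[simp] theorem adj_apply (f : StrongDual ℂ A) (a : A) : adj f a = star (f (star a)) := rfl

theorem norm_adj_le (f : StrongDual ℂ A) : ‖adj f‖ ≤ ‖f‖ :=
  ContinuousLinearMap.opNorm_le_bound _ (norm_nonneg _) fun a => by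
    simpa using f.le_opNorm (star a)

/-- The functional `f ↦ conj (F (f^*))` on `A*`. -/
def biadj (F : StrongDual ℂ (StrongDual ℂ A)) : StrongDual ℂ (StrongDual ℂ A) :=
  LinearMap.mkContinuous
    { toFun := fun f => star (F (adj f))
      map_add' := fun f g => by
        have : adj (f + g) = adj f + adj g := by ext a; simp
        simp [this]
      map_smul' := fun c f => by
        have : adj (c • f) = star c • adj f := by ext a; simp
        simp [this] }
    ‖F‖ fun f => by
      have h := (F.le_opNorm (adj f)).trans
        (mul_le_mul_of_nonneg_left (norm_adj_le f) (norm_nonneg F))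
      simpa using h

/-- The involution on `A**`: `F^* f = conj (F (f^*))`. -/
instance : Star (SecondConj A) := ⟨fun F => biadj F⟩

theorem star_apply (F : SecondConj A) (f : StrongDual ℂ A) : (star F) f = star (F (adj f)) := rfl

/-! Sanity checks: these operations extend the ones of `A`. -/

theorem ι_mul (a b : A) : ι (a * b) = ι a * ι b := rfl

theorem ι_star (a : A) : ι (star a) = star (ι a) := by
  ext f; simp [star_apply]

protected theorem mul_assoc (F G H : SecondConj A) : F * G * H = F * (G * H) := by
  have key : ∀ f, act (G * H) f = act G (act H f) := fun f => by
    ext a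
    simp only [act_apply, mul_apply]
    congr 1
    ext b
    simp only [act_apply, ContinuousLinearMap.comp_apply, ContinuousLinearMap.mul_apply']
    congr 1
    ext c
    simp [mul_assoc]
  ext f
  rw [mul_apply, mul_apply, mul_apply, key]

protected theorem star_star (F : SecondConj A) : star (star F) = F := by
  ext f
  have : adj (adj f) = f := by ext a; simp
  simp [star_apply, this]

/-- A functional on `A**` is normal if it is continuous for the weak⋆ topology that `A**` carries
as the dual of `A*`. -/
def IsNormal (φ : SecondConj A →ₗ[ℂ] ℂ) : Prop :=
  Continuous fun x : WeakDual ℂ (StrongDual ℂ A) => φ (WeakDual.toStrongDual x)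

/-- The extension `ρ̄` of a functional `ρ` on `A` to a normal functional on `A**`: evaluation
at `ρ`.  See `existsUnique_normal_extension`. -/
def normalExt (ρ : StrongDual ℂ A) : SecondConj A →ₗ[ℂ] ℂ where
  toFun F := F ρ
  map_add' _ _ := rfl
  map_smul' _ _ := rfl

@[simp] theorem normalExt_apply (ρ : StrongDual ℂ A) (F : SecondConj A) :
    normalExt ρ F = F ρ := rfl

theorem weakDual_functional_eq_eval {X : Type*} [NormedAddCommGroup X] [NormedSpace ℂ X]
    (φ : StrongDual ℂ X →ₗ[ℂ] ℂ)
    (hφ : Continuous fun x : WeakDual ℂ X => φ (WeakDual.toStrongDual x)) :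
    ∃ f : X, ∀ x : StrongDual ℂ X, φ x = x f := by
  obtain ⟨f, hf⟩ := LinearMap.dualEmbedding_surjective (topDualPairing ℂ X)
    { toFun := fun x => φ x
      map_add' := fun x y => map_add φ x y
      map_smul' := fun c x => map_smul φ c x
      cont := hφ }
  exact ⟨f, fun x => (DFunLike.congr_fun hf x).symm⟩

/-- `ρ̄` is the unique normal functional on `A**` that extends `ρ`. -/
theorem existsUnique_normal_extension (ρ : StrongDual ℂ A) :
    (IsNormal (normalExt ρ) ∧ ∀ a : A, normalExt ρ (ι a) = ρ a) ∧
      ∀ φ : SecondConj A →ₗ[ℂ] ℂ, IsNormal φ → (∀ a : A, φ (ι a) = ρ a) → φ = normalExt ρ := by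
  refine ⟨⟨WeakDual.eval_continuous ρ, fun _ => rfl⟩, fun φ hφ h => ?_⟩
  obtain ⟨f, hf⟩ := weakDual_functional_eq_eval (X := StrongDual ℂ A) φ hφ
  have hfρ : f = ρ := by
    ext a
    exact (hf (ι a)).symm.trans (h a)
  exact LinearMap.ext fun F => by rw [← hfρ]; exact hf F

/-- `p` is the support projection in `A**` of the state `ρ` (and of its normal extension): the
smallest projection at which the normal extension takes the value one. The order of
projections `p ≤ q` is written as `p * q = p`. -/
structure IsSupportProjection (ρ : StrongDual ℂ A) (p : SecondConj A) : Prop where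
  isStarProjection : IsStarProjection p
  normalExt_eq_one : normalExt ρ p = 1
  le_of_normalExt_eq_one :
    ∀ q : SecondConj A, IsStarProjection q → normalExt ρ q = 1 → p * q = p

end SecondConj

/-! ### The ideal `L_ρ`, the algebra `D_ρ` and its normalizer in `ℓ_∞(A)` -/

section Sequences

variable {A : Type*} [NonUnitalCStarAlgebra A]

/-- The diagonal embedding `Δ : A → ℓ_∞(A)`, `Δ(a) = (a, a, …)`. -/
def diag (a : A) : EllInfty A :=
  ⟨fun _ => a, memℓp_infty ⟨‖a‖, by rintro _ ⟨_, rfl⟩; exact le_rfl⟩⟩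

@[simp] theorem diag_apply (a : A) (n : ℕ) : diag a n = a := rfl

/-- `L_ρ`: the bounded sequences `(a₁, a₂, …)` in `A` with `lim_{n → ω} ρ(aₙ^* aₙ) = 0`. -/
def leftIdealL (ω : Ultrafilter ℕ) (ρ : StrongDual ℂ A) : Set (EllInfty A) :=
  {a | Tendsto (fun n => ρ (star (a n) * a n)) ω (𝓝 0)}

/-- `D_ρ = L_ρ ∩ L_ρ^*`. -/
def hereditaryD (ω : Ultrafilter ℕ) (ρ : StrongDual ℂ A) : Set (EllInfty A) :=
  {a | a ∈ leftIdealL ω ρ ∧ star a ∈ leftIdealL ω ρ}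

/-- The normalizer `N(D) = {x ∈ ℓ_∞(A) : xD + Dx ⊆ D}`. -/
def normalizerN (D : Set (EllInfty A)) : Set (EllInfty A) :=
  {x | ∀ d ∈ D, ∀ e ∈ D, x * d + e * x ∈ D}

end Sequences

end

/-! Let N be the left kernel {F : ρ̄(F⋆F) = 0} in A**. By Cauchy–Schwarz N is a left ideal, and N =
A**(1 - p) for the support projection p, so p is central as soon as N is also a right ideal.

Condition (i) makes N a right ideal. In the GNS space of ρ, F ∈ N and b ∈ A are approximated by a
bounded sequence in A with Λ(aₙ) → 0 and Λ(aₙb) converging in norm to the vector of Fb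
(`lift_prod_mem_closure`); (i) forces that vector to vanish. Normality then replaces b by any
element of A**. Conversely, if p is central and ρ̄(aₙ⋆aₙ) → 0, a weak⋆ limit x of aₙ⋆aₙ satisfies xp
= 0, so b⋆xb is killed by p and ρ̄(b⋆xb) = 0. This gives (iv), and (iii) and (i) are special cases.
For (ii) ⇒ (i), a⋆a ∈ D_ρ whenever a ∈ L_ρ, and pairing a⋆aΔ(b) with Λ(b) returns ρ(b⋆aₙ⋆aₙb).

All this needs A** to be a C⋆-algebra with separately weak⋆ continuous product. The source is
`exists_positive_dominating`: with |f(a)|² ≤ g(a⋆a), f becomes a vector functional on the GNS space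
of g, where Arens regularity and the C⋆-identity are Hilbert space computations. The domination is
Hahn–Banach applied to the bound Σ|f(aᵢ)|² ≤ ‖f‖²‖Σaᵢ⋆aᵢ‖, which `ColumnBounded` encodes through y =
Σ conj(f(aᵢ)) aᵢ. -/

noncomputable section

/-! ### Domination of bounded functionals by positive ones -/

section Domination

variable {A : Type*} [NonUnitalCStarAlgebra A]

/-- The pair `(s, t)` is bounded by `f` if `t = f y` for some `y` with `y⋆ y ≤ t s`. -/
def ColumnBounded [PartialOrder A] (f : StrongDual ℂ A) (s : A) (t : ℝ) : Prop :=
  0 ≤ s ∧ 0 ≤ t ∧ ∃ y : A, f y = t ∧ star y * y ≤ t • s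

namespace ColumnBounded

variable [PartialOrder A] {f : StrongDual ℂ A} {s s' : A} {t t' : ℝ}

theorem zero (f : StrongDual ℂ A) : ColumnBounded f 0 0 :=
  ⟨le_rfl, le_rfl, 0, by simp, by simp⟩

variable [StarOrderedRing A]

theorem star_mul_self (f : StrongDual ℂ A) (a : A) :
    ColumnBounded f (star a * a) (‖f a‖ ^ 2) := by
  refine ⟨star_mul_self_nonneg a, by positivity, star (f a) • a, ?_, ?_⟩
  · simp [Complex.conj_mul']
  · refine le_of_eq ?_
    rw [star_smul, star_star, smul_mul_smul_comm, ← Complex.coe_smul]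
    congr 1
    simp [Complex.mul_conj']

theorem smul (h : ColumnBounded f s t) {c : ℝ} (hc : 0 ≤ c) :
    ColumnBounded f (c • s) (c * t) := by
  obtain ⟨hs, ht, y, hy, hle⟩ := h
  refine ⟨smul_nonneg hc hs, by positivity, (c : ℂ) • y, by simp [hy], ?_⟩
  have h2 : star ((c : ℂ) • y) * ((c : ℂ) • y) = (c * c) • (star y * y) := by
    rw [star_smul, smul_mul_smul_comm, ← Complex.coe_smul]
    simp
  rw [h2, smul_smul, show c * t * c = (c * c) * t by ring, mul_smul (c * c) t s]
  exact smul_le_smul_of_nonneg_left hle (by positivity)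

/-- The witnesses add, as in Cauchy–Schwarz: the cross terms of (y + y')⋆(y + y') are controlled by
positivity of the square of t'y - ty'. -/
theorem add (h : ColumnBounded f s t) (h' : ColumnBounded f s' t') :
    ColumnBounded f (s + s') (t + t') := by
  obtain ⟨hs, ht, y, hy, hle⟩ := h
  obtain ⟨hs', ht', y', hy', hle'⟩ := h'
  refine ⟨add_nonneg hs hs', add_nonneg ht ht', y + y', by simp [hy, hy'], ?_⟩
  have zero_case : ∀ {z u : A}, star z * z ≤ (0 : ℝ) • u → z = 0 := fun {z u} hz => by
    rw [zero_smul] at hz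
    exact CStarRing.star_mul_self_eq_zero_iff z |>.1 (le_antisymm hz (star_mul_self_nonneg z))
  -- The cross estimate is divided by tt' below; if t or t' vanishes, so does its witness.
  rcases ht.eq_or_lt with rfl | ht
  · rw [zero_case hle, zero_add, zero_add, smul_add]
    exact hle'.trans (le_add_of_nonneg_left (smul_nonneg ht' hs))
  rcases ht'.eq_or_lt with rfl | ht'
  · rw [zero_case hle', add_zero, add_zero, smul_add]
    exact hle.trans (le_add_of_nonneg_right (smul_nonneg ht.le hs'))
  have cross : star y * y' + star y' * y ≤ t' • s + t • s' := by
    have h0 := star_mul_self_nonneg (t' • y - t • y')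
    have e : star (t' • y - t • y') * (t' • y - t • y') =
        (t' * t') • (star y * y) + (t * t) • (star y' * y')
          - (t * t') • (star y * y' + star y' * y) := by
      simp only [star_sub, star_smul, star_trivial, sub_mul, mul_sub, smul_mul_smul_comm, smul_add]
      rw [mul_comm t' t]
      abel
    rw [e, sub_nonneg] at h0
    have h1 : (t * t') • (star y * y' + star y' * y) ≤ (t * t') • (t' • s + t • s') := by
      refine h0.trans ?_
      have e2 : (t * t') • (t' • s + t • s') = (t' * t') • (t • s) + (t * t) • (t' • s') := by
        simp only [smul_add, smul_smul]
        congr 2 <;> ring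
      rw [e2]
      exact add_le_add (smul_le_smul_of_nonneg_left hle (by positivity))
        (smul_le_smul_of_nonneg_left hle' (by positivity))
    exact le_of_smul_le_smul_left h1 (by positivity)
  calc star (y + y') * (y + y')
      = star y * y + star y' * y' + (star y * y' + star y' * y) := by
        rw [star_add, add_mul, mul_add, mul_add]; abel
    _ ≤ t • s + t' • s' + (t' • s + t • s') := add_le_add (add_le_add hle hle') cross
    _ = (t + t') • (s + s') := by rw [add_smul, smul_add, smul_add]; abel

/-- Combine t = f(y) ≤ ‖f‖‖y‖ with ‖y‖² ≤ t‖s‖ and cancel one factor t. -/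
theorem le_norm (h : ColumnBounded f s t) : t ≤ ‖f‖ ^ 2 * ‖s‖ := by
  obtain ⟨hs, ht, y, hy, hle⟩ := h
  have h1 : ‖y‖ ^ 2 ≤ t * ‖s‖ := by
    have := CStarAlgebra.norm_le_norm_of_nonneg_of_le (star_mul_self_nonneg y) hle
    rwa [CStarRing.norm_star_mul_self, norm_smul, Real.norm_of_nonneg ht, ← sq] at this
  have h2 : t ≤ ‖f‖ * ‖y‖ := by
    have := f.le_opNorm y
    rwa [hy, Complex.norm_real, Real.norm_of_nonneg ht] at this
  rcases ht.eq_or_lt with rfl | ht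
  · positivity
  have h3 : t ^ 2 ≤ ‖f‖ ^ 2 * (t * ‖s‖) := by
    calc t ^ 2 ≤ (‖f‖ * ‖y‖) ^ 2 := by gcongr
      _ = ‖f‖ ^ 2 * ‖y‖ ^ 2 := by ring
      _ ≤ _ := by gcongr
  nlinarith

end ColumnBounded

theorem exists_real_dominating (f : StrongDual ℂ A) : ∃ φ : A →ₗ[ℝ] ℝ,
    (∀ x, |φ x| ≤ ‖f‖ ^ 2 * ‖x‖) ∧ ∀ a, ‖f a‖ ^ 2 ≤ φ (star a * a) := by
  let _ : PartialOrder A := CStarAlgebra.spectralOrder A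
  have _ : StarOrderedRing A := CStarAlgebra.spectralOrderedRing A
  -- The cone plays the role of the epigraph of the sublinear functional x ↦ inf (‖f‖²‖x + s‖ - t),
  -- over bounded pairs (s, t).
  let C : PointedCone ℝ (A × ℝ) :=
    { carrier := {p | ∃ s t, ColumnBounded f s t ∧ ‖f‖ ^ 2 * ‖p.1 + s‖ ≤ p.2 + t}
      zero_mem' := ⟨0, 0, .zero f, by simp⟩
      add_mem' := by
        rintro ⟨x, r⟩ ⟨x', r'⟩ ⟨s, t, h, hle⟩ ⟨s', t', h', hle'⟩
        refine ⟨s + s', t + t', h.add h', ?_⟩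
        dsimp only at hle hle' ⊢
        have : ‖x + x' + (s + s')‖ ≤ ‖x + s‖ + ‖x' + s'‖ := by
          rw [show x + x' + (s + s') = (x + s) + (x' + s') by abel]
          exact norm_add_le _ _
        simp only [Prod.mk_add_mk]
        nlinarith [sq_nonneg ‖f‖, mul_le_mul_of_nonneg_left this (sq_nonneg ‖f‖)]
      smul_mem' := by
        rintro ⟨c, hc⟩ ⟨x, r⟩ ⟨s, t, h, hle⟩
        refine ⟨c • s, c * t, h.smul hc, ?_⟩
        dsimp only at hle ⊢
        simp only [Nonneg.mk_smul, Prod.smul_mk, smul_eq_mul]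
        rw [← smul_add, norm_smul, Real.norm_of_nonneg hc]
        nlinarith [mul_le_mul_of_nonneg_left hle hc] }
  let D : A × ℝ →ₗ.[ℝ] ℝ :=
    { domain := LinearMap.ker (LinearMap.fst ℝ A ℝ)
      toFun := (LinearMap.snd ℝ A ℝ).comp (Submodule.subtype _) }
  obtain ⟨g, hg, hpos⟩ := riesz_extension C D
    -- On the axis x = 0 the cone contains only r ≥ 0: this is `le_norm`.
    (by
      rintro ⟨⟨x, r⟩, hx⟩ ⟨s, t, h, hle⟩
      have hx : x = 0 := hx
      subst hx
      have := h.le_norm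
      simp only [zero_add] at hle
      change 0 ≤ r
      linarith)
    (by
      rintro ⟨x, r⟩
      refine ⟨⟨(0, ‖f‖ ^ 2 * ‖x‖ - r), rfl⟩, 0, 0, .zero f, ?_⟩
      simp)
  have g_snd : ∀ r : ℝ, g (0, r) = r := fun r => hg ⟨(0, r), rfl⟩
  have g_split : ∀ x r, g (x, r) = g (x, 0) + r := fun x r => by
    conv_rhs => rw [← g_snd r, ← map_add, Prod.mk_add_mk, add_zero, zero_add]
  refine ⟨-(g.comp (LinearMap.inl ℝ A ℝ)), fun x => ?_, fun a => ?_⟩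
  · have h1 : ∀ x : A, 0 ≤ g (x, 0) + ‖f‖ ^ 2 * ‖x‖ := fun x => by
      rw [← g_split]
      exact hpos _ ⟨0, 0, .zero f, by simp⟩
    have h2 := h1 x
    have h3 := h1 (-x)
    rw [show ((-x, 0) : A × ℝ) = -(x, 0) by simp, map_neg, norm_neg] at h3
    simp only [LinearMap.neg_apply, LinearMap.comp_apply, LinearMap.inl_apply]
    rw [abs_neg, abs_le]
    constructor <;> linarith
  · have h1 : 0 ≤ g (-(star a * a), -‖f a‖ ^ 2) :=
      hpos _ ⟨_, _, .star_mul_self f a, by simp⟩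
    rw [g_split, show ((-(star a * a), 0) : A × ℝ) = -(star a * a, 0) by simp, map_neg] at h1
    simp only [LinearMap.neg_apply, LinearMap.comp_apply, LinearMap.inl_apply]
    linarith

/-- Every bounded functional on a C⋆-algebra is dominated by a positive one. -/
theorem exists_positive_dominating (f : StrongDual ℂ A) : ∃ g : StrongDual ℂ A,
    ‖g‖ ≤ ‖f‖ ^ 2 ∧ ∀ a, ((‖f a‖ ^ 2 : ℝ) : ℂ) ≤ g (star a * a) := by
  obtain ⟨φ, hφ, hdom⟩ := exists_real_dominating f
  -- Averaging over the involution makes ψ vanish on skew-adjoint elements such as i a⋆a, so its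
  -- complex extension is real on a⋆a.
  let ψ : A →ₗ[ℝ] ℝ :=
    { toFun := fun x => (φ x + φ (star x)) / 2
      map_add' := fun x y => by simp only [star_add, map_add]; ring
      map_smul' := fun c x => by
        simp only [star_smul, star_trivial, map_smul, smul_eq_mul, RingHom.id_apply]; ring }
  have ψ_apply : ∀ x, ψ x = (φ x + φ (star x)) / 2 := fun _ => rfl
  let Ψ : StrongDual ℝ A := ψ.mkContinuous (‖f‖ ^ 2) fun x => by
    have h1 := abs_le.1 (hφ x)
    have h2 := abs_le.1 (hφ (star x))
    rw [norm_star] at h2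
    rw [Real.norm_eq_abs, ψ_apply, abs_le]
    constructor <;> linarith
  refine ⟨Ψ.extendRCLike, ?_, fun a => ?_⟩
  · rw [StrongDual.norm_extendRCLike]
    exact ψ.mkContinuous_norm_le (by positivity) _
  · have hre : (Ψ.extendRCLike (star a * a) : ℂ).re = φ (star a * a) := by
      have := StrongDual.re_extendRCLike_apply (𝕜 := ℂ) Ψ (star a * a)
      rw [RCLike.re_eq_complex_re] at this
      rw [this]
      change ψ _ = _
      rw [ψ_apply, star_mul, star_star]; ring
    have him : (Ψ.extendRCLike (star a * a) : ℂ).im = 0 := by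
      have := StrongDual.im_extendRCLike_apply (𝕜 := ℂ) Ψ (star a * a)
      rw [RCLike.im_eq_complex_im] at this
      rw [this]
      change - ψ _ = _
      rw [ψ_apply, star_smul, star_mul, star_star]
      simp
    rw [Complex.le_def]
    simp only [Complex.ofReal_re, Complex.ofReal_im, hre, him, and_true]
    exact hdom a

end Domination

/-! ### GNS spaces and vector functionals -/

section GNS

universe u
variable {A : Type u} [NonUnitalCStarAlgebra A]

/-- The Gelfand–Naimark–Segal space of a positive functional on a C⋆-algebra. -/
theorem exists_gns (g : StrongDual ℂ A) (hg : ∀ a, 0 ≤ g (star a * a)) :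
    ∃ (H : Type u) (_ : NormedAddCommGroup H) (_ : InnerProductSpace ℂ H) (_ : CompleteSpace H)
      (Λ : A →L[ℂ] H), DenseRange Λ ∧ ∀ a b, inner ℂ (Λ a) (Λ b) = g (star a * b) := by
  let _ : PartialOrder A := CStarAlgebra.spectralOrder A
  have _ : StarOrderedRing A := CStarAlgebra.spectralOrderedRing A
  let G : A →ₚ[ℂ] ℂ := PositiveLinearMap.mk₀ g.toLinearMap fun x hx => by
    obtain ⟨a, rfl⟩ := CStarAlgebra.nonneg_iff_eq_star_mul_self.1 hx
    exact hg a
  have hG : ∀ a, G a = g a := fun _ => rfl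
  let Λ₀ : A →ₗ[ℂ] G.GNS :=
    { toFun := fun a => ((G.toPreGNS a : G.PreGNS) : G.GNS)
      map_add' := fun a b => by simp [UniformSpace.Completion.coe_add]
      map_smul' := fun c a => by simp }
  have inner_Λ₀ : ∀ a b, inner ℂ (Λ₀ a) (Λ₀ b) = g (star a * b) := fun a b => by
    change inner ℂ ((G.toPreGNS a : G.PreGNS) : G.GNS) ((G.toPreGNS b : G.PreGNS) : G.GNS) = _
    rw [UniformSpace.Completion.inner_coe, PositiveLinearMap.preGNS_inner_def]
    rfl
  let Λ : A →L[ℂ] G.GNS := Λ₀.mkContinuous (Real.sqrt ‖g‖) fun a => by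
    rw [← Real.sqrt_sq (norm_nonneg (Λ₀ a)), ← Real.sqrt_sq (norm_nonneg a),
      ← Real.sqrt_mul (norm_nonneg g)]
    refine Real.sqrt_le_sqrt ?_
    rw [← inner_self_eq_norm_sq (𝕜 := ℂ), inner_Λ₀]
    calc RCLike.re (g (star a * a)) ≤ ‖g (star a * a)‖ := RCLike.re_le_norm _
      _ ≤ ‖g‖ * ‖star a * a‖ := g.le_opNorm _
      _ = ‖g‖ * ‖a‖ ^ 2 := by rw [CStarRing.norm_star_mul_self, sq]
  refine ⟨G.GNS, inferInstance, inferInstance, inferInstance, Λ, ?_, inner_Λ₀⟩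
  exact (UniformSpace.Completion.denseRange_coe (α := G.PreGNS)).comp
    G.toPreGNS.surjective.denseRange (UniformSpace.Completion.continuous_coe _)

/-- A functional dominated by `‖Λ a‖` is represented by a vector. -/
theorem exists_vector_of_dominated {H : Type*} [NormedAddCommGroup H] [InnerProductSpace ℂ H]
    [CompleteSpace H] (Λ : A →L[ℂ] H) (hΛ : DenseRange Λ) (f : StrongDual ℂ A) {C : ℝ}
    (hC : 0 ≤ C) (hf : ∀ a, ‖f a‖ ≤ C * ‖Λ a‖) :
    ∃ η : H, ‖η‖ ≤ C ∧ f = (innerSL ℂ η).comp Λ := by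
  let φ : StrongDual ℂ H := f.toLinearMap.extendOfNorm Λ.toLinearMap
  refine ⟨(InnerProductSpace.toDual ℂ H).symm φ, ?_, ?_⟩
  · rw [LinearIsometryEquiv.norm_map]
    exact LinearMap.opNorm_extendOfNorm_le hΛ hC hf
  · ext a
    rw [ContinuousLinearMap.comp_apply, innerSL_apply_apply, InnerProductSpace.toDual_symm_apply]
    exact (LinearMap.extendOfNorm_eq (f := f.toLinearMap) (e := Λ.toLinearMap) hΛ ⟨C, hf⟩ a).symm

end GNS

namespace SecondConj

/-! ### Second transposes of operators into Hilbert spaces -/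

section Lift

variable {A : Type*} [NonUnitalCStarAlgebra A]
  {H : Type*} [NormedAddCommGroup H] [InnerProductSpace ℂ H] [CompleteSpace H]

theorem add_apply (F G : SecondConj A) (f : StrongDual ℂ A) : (F + G) f = F f + G f := rfl

theorem sub_apply (F G : SecondConj A) (f : StrongDual ℂ A) : (F - G) f = F f - G f := rfl

theorem smul_apply (c : ℂ) (F : SecondConj A) (f : StrongDual ℂ A) : (c • F) f = c * F f := rfl

theorem apply_add (F : SecondConj A) (f g : StrongDual ℂ A) : F (f + g) = F f + F g :=
  ContinuousLinearMap.map_add (F : StrongDual ℂ (StrongDual ℂ A)) f g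

theorem apply_smul (F : SecondConj A) (c : ℂ) (f : StrongDual ℂ A) : F (c • f) = c * F f :=
  ContinuousLinearMap.map_smul (F : StrongDual ℂ (StrongDual ℂ A)) c f

theorem norm_apply_le (F : SecondConj A) (f : StrongDual ℂ A) : ‖F f‖ ≤ ‖F‖ * ‖f‖ :=
  ContinuousLinearMap.le_opNorm (F : StrongDual ℂ (StrongDual ℂ A)) f

theorem norm_le {F : SecondConj A} {C : ℝ} (hC : 0 ≤ C) (h : ∀ f, ‖F f‖ ≤ C * ‖f‖) : ‖F‖ ≤ C :=
  ContinuousLinearMap.opNorm_le_bound (F : StrongDual ℂ (StrongDual ℂ A)) hC h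

/-- The second transpose of T takes values in H because Hilbert spaces are reflexive; conjugating F
makes the functional linear in η. -/
theorem exists_lift (T : A →L[ℂ] H) (F : SecondConj A) :
    ∃ v : H, ∀ η : H, inner ℂ η v = F ((innerSL ℂ η).comp T) := by
  let ℓ : H →ₗ[ℂ] ℂ :=
    { toFun := fun η => star (F ((innerSL ℂ η).comp T))
      map_add' := fun η ζ => by
        rw [map_add, ContinuousLinearMap.add_comp, apply_add, star_add]
      map_smul' := fun c η => by
        rw [map_smulₛₗ, ContinuousLinearMap.smul_comp, apply_smul, star_mul', RingHom.id_apply,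
          smul_eq_mul]
        simp }
  let L : StrongDual ℂ H := ℓ.mkContinuous (‖F‖ * ‖T‖) fun η => by
    change ‖star (F ((innerSL ℂ η).comp T))‖ ≤ _
    rw [norm_star]
    refine (norm_apply_le F _).trans ?_
    rw [mul_assoc]
    refine mul_le_mul_of_nonneg_left ?_ (norm_nonneg F)
    refine (ContinuousLinearMap.opNorm_comp_le _ _).trans ?_
    rw [innerSL_apply_norm, mul_comm]
  refine ⟨(InnerProductSpace.toDual ℂ H).symm L, fun η => ?_⟩
  rw [← inner_conj_symm, InnerProductSpace.toDual_symm_apply]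
  exact star_star _

/-- The normal extension to `A**` of a bounded operator from `A` to a Hilbert space. -/
def lift (T : A →L[ℂ] H) (F : SecondConj A) : H := (exists_lift T F).choose

theorem inner_lift (T : A →L[ℂ] H) (F : SecondConj A) (η : H) :
    inner ℂ η (lift T F) = F ((innerSL ℂ η).comp T) := (exists_lift T F).choose_spec η

theorem apply_lift (T : A →L[ℂ] H) (F : SecondConj A) (ψ : StrongDual ℂ H) :
    ψ (lift T F) = F (ψ.comp T) := by
  obtain ⟨η, rfl⟩ := (InnerProductSpace.toDual ℂ H).surjective ψ
  exact inner_lift T F η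

/-- The normal extensions of bounded operators are approximated in norm on bounded sets. -/
theorem lift_prod_mem_closure {K : Type*} [NormedAddCommGroup K] [InnerProductSpace ℂ K]
    [CompleteSpace K] (T : A →L[ℂ] H) (S : A →L[ℂ] K) (F : SecondConj A) :
    (lift T F, lift S F) ∈ closure ((T.prod S) '' Metric.closedBall 0 ‖F‖) := by
  by_contra hmem
  -- The image of a ball is convex, so its norm closure can be separated from an outside point;
  -- treating T and S as one operator approximates both with the same elements of A.
  have hconv : Convex ℝ (closure ((T.prod S) '' Metric.closedBall 0 ‖F‖)) :=
    ((convex_closedBall (0 : A) ‖F‖).linear_image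
      ((T.prod S).toLinearMap.restrictScalars ℝ)).closure
  obtain ⟨φ, u, hu, hv⟩ := RCLike.geometric_hahn_banach_closed_point (𝕜 := ℂ) hconv
    isClosed_closure hmem
  have hφ : φ (lift T F, lift S F) = F (φ.comp (T.prod S)) := by
    have e : φ.comp (T.prod S) = (φ.comp (.inl ℂ H K)).comp T + (φ.comp (.inr ℂ H K)).comp S := by
      ext a
      simp only [ContinuousLinearMap.comp_apply, ContinuousLinearMap.prod_apply,
        _root_.add_apply, ContinuousLinearMap.inl_apply,
        ContinuousLinearMap.inr_apply]
      rw [← map_add]; simp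
    rw [e, apply_add, ← apply_lift, ← apply_lift, ContinuousLinearMap.comp_apply,
      ContinuousLinearMap.comp_apply, ← map_add]
    simp
  have hball : ∀ a : A, ‖a‖ ≤ ‖F‖ → (φ (T a, S a)).re ≤ u := fun a ha =>
    (hu _ (subset_closure ⟨a, by simpa using ha, rfl⟩)).le
  have hle : ‖F‖ * ‖φ.comp (T.prod S)‖ ≤ u := by
    have hu0 : 0 ≤ u := by
      have h := hball 0 (by simp)
      rwa [map_zero, map_zero, Prod.mk_zero_zero, map_zero, Complex.zero_re] at h
    rcases (norm_nonneg F).eq_or_lt with h0 | hpos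
    · rw [← h0, zero_mul]; exact hu0
    rw [mul_comm, ← le_div_iff₀ hpos]
    refine ContinuousLinearMap.opNorm_le_bound _ (by positivity) fun a => ?_
    set z : ℂ := φ.comp (T.prod S) a with hz
    rcases eq_or_ne a 0 with rfl | ha
    · rw [hz, map_zero, norm_zero, norm_zero, mul_zero]
    rcases eq_or_ne z 0 with h | hz0
    · rw [h, norm_zero]; positivity
    have ha' : 0 < ‖a‖ := norm_pos_iff.2 ha
    have hz' : 0 < ‖z‖ := norm_pos_iff.2 hz0
    -- Rescales a to norm ‖F‖ and rotates its value to the positive axis, so the bound on real parts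
    -- becomes a bound on the norm.
    let c : ℂ := (‖F‖ / (‖a‖ * ‖z‖) : ℝ) * star z
    have h1 : ‖c • a‖ ≤ ‖F‖ := by
      rw [norm_smul, norm_mul, norm_star, Complex.norm_real, Real.norm_of_nonneg (by positivity)]
      refine le_of_eq ?_
      field_simp
    have h2 := hball _ h1
    have h3 : φ (T (c • a), S (c • a)) = c * z := by
      rw [hz, ← smul_eq_mul, ← map_smul]; rfl
    have h4 : c * z = ((‖F‖ / (‖a‖ * ‖z‖) * ‖z‖ ^ 2 : ℝ) : ℂ) := by
      simp only [c]
      rw [mul_assoc, Complex.star_def, Complex.conj_mul']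
      push_cast; ring
    rw [h3, h4, Complex.ofReal_re] at h2
    have h5 : ‖F‖ / (‖a‖ * ‖z‖) * ‖z‖ ^ 2 = ‖F‖ * ‖z‖ / ‖a‖ := by field_simp
    rw [h5, div_le_iff₀ ha'] at h2
    rw [div_mul_eq_mul_div, le_div_iff₀ hpos]
    linarith
  rw [hφ] at hv
  have h1 : RCLike.re (F (φ.comp (T.prod S))) ≤ u :=
    (RCLike.re_le_norm _).trans ((norm_apply_le F _).trans hle)
  exact absurd hv (not_lt.2 h1)

end Lift

/-! ### Arens regularity -/

section Arens

universe u
variable {A : Type u} [NonUnitalCStarAlgebra A]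

/-- The normal extension of a positive functional is computed in its GNS space. -/
theorem star_mul_apply_eq_inner {H : Type*} [NormedAddCommGroup H] [InnerProductSpace ℂ H]
    [CompleteSpace H] {g : StrongDual ℂ A} {Λ : A →L[ℂ] H}
    (hΛ : ∀ a b, inner ℂ (Λ a) (Λ b) = g (star a * b)) (F G : SecondConj A) :
    (star F * G) g = inner ℂ (lift Λ F) (lift Λ G) := by
  have h1 : adj (act G g) = (innerSL ℂ (lift Λ G)).comp Λ := by
    ext a
    rw [adj_apply, act_apply, ContinuousLinearMap.comp_apply, innerSL_apply_apply,
      ← inner_conj_symm, inner_lift]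
    congr 2
    ext b
    simp [hΛ]
  rw [mul_apply, star_apply, h1, ← inner_lift, ← inner_conj_symm]
  exact star_star _

/-- The functional `f · F` on `A`: it maps `b` to `F (a ↦ f (a * b))`. -/
def actRight (F : SecondConj A) : StrongDual ℂ A →L[ℂ] StrongDual ℂ A :=
  (ContinuousLinearMap.compL ℂ A (StrongDual ℂ A) ℂ (F : StrongDual ℂ (StrongDual ℂ A))).comp
    ((ContinuousLinearMap.compL ℂ A (A →L[ℂ] A) (StrongDual ℂ A)).flip
      (ContinuousLinearMap.mul ℂ A).flip |>.comp (ContinuousLinearMap.compL ℂ A A ℂ))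

theorem actRight_apply (F : SecondConj A) (f : StrongDual ℂ A) (b : A) :
    actRight F f b = F (f.comp ((ContinuousLinearMap.mul ℂ A).flip b)) := rfl

theorem mul_ι_apply (F : SecondConj A) (b : A) (f : StrongDual ℂ A) :
    (F * ι b) f = actRight F f b := by
  rw [mul_apply, actRight_apply]; rfl

/-- C⋆-algebras are Arens regular. -/
theorem mul_apply' (F G : SecondConj A) (f : StrongDual ℂ A) : (F * G) f = G (actRight F f) := by
  obtain ⟨g, -, hg⟩ := exists_positive_dominating f
  have hpos : ∀ a, 0 ≤ g (star a * a) := fun a =>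
    le_trans (by exact_mod_cast sq_nonneg ‖f a‖) (hg a)
  obtain ⟨H, _, _, _, Λ, hd, hΛ⟩ := exists_gns g hpos
  obtain ⟨η, -, rfl⟩ := exists_vector_of_dominated Λ hd f zero_le_one fun a => by
    have h := hg a
    rw [← hΛ, inner_self_eq_norm_sq_to_K] at h
    have h' : ‖f a‖ ^ 2 ≤ ‖Λ a‖ ^ 2 := Complex.real_le_real.1 (by simpa using h)
    rw [one_mul]
    exact (sq_le_sq₀ (norm_nonneg _) (norm_nonneg _)).1 h'
  -- The domination concerns this η only, whereas the identity is closed in η and holds for every η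
  -- once checked on the dense range of Λ.
  clear hg
  induction η using hd.induction_on with
  | hp =>
    have hc : Continuous fun η : H => (innerSL ℂ η).comp Λ :=
      ((ContinuousLinearMap.compL ℂ A H ℂ).flip Λ).continuous.comp (innerSL ℂ).continuous
    exact isClosed_eq
      ((F * G : StrongDual ℂ (StrongDual ℂ A)).continuous.comp hc)
      ((ContinuousLinearMap.continuous (G : StrongDual ℂ (StrongDual ℂ A))).comp
        ((actRight F).continuous.comp hc))
  | ih c =>
    -- For η = Λ(c), f(ab) = ⟨S(a⋆), Λ(b)⟩. Both products therefore evaluate to ⟨`lift S (star F)`,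
    -- `lift Λ G`⟩.
    let S : A →L[ℂ] H := Λ.comp ((ContinuousLinearMap.mul ℂ A).flip c)
    have inner_S : ∀ a b, inner ℂ (S (star a)) (Λ b) = g (star c * (a * b)) := fun a b => by
      simp only [S, ContinuousLinearMap.comp_apply, ContinuousLinearMap.flip_apply,
        ContinuousLinearMap.mul_apply']
      rw [hΛ, star_mul, star_star, mul_assoc]
    set f := (innerSL ℂ (Λ c)).comp Λ with hf
    have hf_apply : ∀ a, f a = g (star c * a) := fun a => by simp [hf, hΛ]
    have h1 : adj (act G f) = (innerSL ℂ (lift Λ G)).comp S := by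
      ext a
      rw [adj_apply, act_apply, ContinuousLinearMap.comp_apply, innerSL_apply_apply,
        ← inner_conj_symm, inner_lift]
      congr 2
      ext b
      simp only [ContinuousLinearMap.comp_apply, innerSL_apply_apply,
        ContinuousLinearMap.mul_apply', hf_apply]
      rw [← inner_S, star_star]
    have h2 : actRight F f = (innerSL ℂ (lift S (star F))).comp Λ := by
      ext b
      rw [actRight_apply, ContinuousLinearMap.comp_apply, innerSL_apply_apply,
        ← inner_conj_symm, inner_lift, star_apply]
      rw [Complex.star_def, Complex.conj_conj]
      congr 1
      ext a
      simp only [ContinuousLinearMap.comp_apply, innerSL_apply_apply, adj_apply, hf_apply,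
        ContinuousLinearMap.flip_apply, ContinuousLinearMap.mul_apply']
      rw [Complex.star_def, inner_conj_symm, inner_S]
    rw [h2, ← inner_lift Λ G, ← inner_conj_symm, inner_lift S, ← h1, star_apply, mul_apply,
      Complex.star_def, Complex.conj_conj]
    congr 1
    ext a
    simp

end Arens
end SecondConj

namespace SecondConj

variable {A : Type*} [NonUnitalCStarAlgebra A]

/-! ### Weak⋆ limits and separate continuity -/

section WeakLimit

/-- Bounded families in `A**` converge weak⋆ along ultrafilters. -/
theorem exists_weak_limit {I : Type*} (U : Ultrafilter I) (F : I → SecondConj A) {C : ℝ}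
    (hF : ∀ᶠ i in (U : Filter I), ‖F i‖ ≤ C) :
    ∃ L : SecondConj A, ∀ f, Tendsto (fun i => F i f) U (𝓝 (L f)) := by
  let F' : I → WeakDual ℂ (StrongDual ℂ A) := fun i =>
    StrongDual.toWeakDual (F i : StrongDual ℂ (StrongDual ℂ A))
  have hK := WeakDual.isCompact_closedBall (𝕜 := ℂ) (E := StrongDual ℂ A) 0 C
  obtain ⟨L, -, hL⟩ := hK.ultrafilter_le_nhds (U.map F') (by
    rw [le_principal_iff]
    change _ ∈ Filter.map F' U
    rw [mem_map]
    filter_upwards [hF] with i hi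
    rw [Set.mem_preimage, Set.mem_preimage, mem_closedBall_zero_iff]
    exact hi)
  refine ⟨(WeakDual.toStrongDual L : StrongDual ℂ (StrongDual ℂ A)), fun f => ?_⟩
  have h1 : Tendsto F' U (𝓝 L) := hL
  exact ((WeakDual.eval_continuous f).tendsto L).comp h1

/-- This is where Arens regularity enters; continuity in the left factor is immediate from the
definition of the product. -/
theorem tendsto_mul_left {I : Type*} {l : Filter I} {F : I → SecondConj A} {L : SecondConj A}
    (h : ∀ f, Tendsto (fun i => F i f) l (𝓝 (L f))) (G : SecondConj A) (f : StrongDual ℂ A) :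
    Tendsto (fun i => (G * F i) f) l (𝓝 ((G * L) f)) := by
  simp only [mul_apply' G]
  exact h _

theorem tendsto_mul_right {I : Type*} {l : Filter I} {F : I → SecondConj A} {L : SecondConj A}
    (h : ∀ f, Tendsto (fun i => F i f) l (𝓝 (L f))) (G : SecondConj A) (f : StrongDual ℂ A) :
    Tendsto (fun i => (F i * G) f) l (𝓝 ((L * G) f)) := by
  simp only [mul_apply]
  exact h _

theorem tendsto_star {I : Type*} {l : Filter I} {F : I → SecondConj A} {L : SecondConj A}
    (h : ∀ f, Tendsto (fun i => F i f) l (𝓝 (L f))) (f : StrongDual ℂ A) :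
    Tendsto (fun i => (star (F i)) f) l (𝓝 ((star L) f)) := by
  simp only [star_apply]
  exact (continuous_star.tendsto _).comp (h _)

end WeakLimit

/-! ### The C⋆-algebra structure of A** -/

section Algebra

theorem norm_act_le (G : SecondConj A) (f : StrongDual ℂ A) : ‖act G f‖ ≤ ‖G‖ * ‖f‖ := by
  refine ContinuousLinearMap.opNorm_le_bound _ (by positivity) fun a => ?_
  rw [act_apply, mul_assoc]
  refine (norm_apply_le G _).trans (mul_le_mul_of_nonneg_left ?_ (norm_nonneg G))
  refine (ContinuousLinearMap.opNorm_comp_le _ _).trans ?_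
  exact mul_le_mul_of_nonneg_left (ContinuousLinearMap.opNorm_mul_apply_le ℂ A a) (norm_nonneg f)

protected theorem norm_mul_le (F G : SecondConj A) : ‖F * G‖ ≤ ‖F‖ * ‖G‖ :=
  norm_le (by positivity) fun f => by
    rw [mul_apply, mul_assoc]
    exact (norm_apply_le F _).trans
      (mul_le_mul_of_nonneg_left (norm_act_le G f) (norm_nonneg F))

protected theorem star_mul (F G : SecondConj A) : star (F * G) = star G * star F := by
  ext f
  rw [mul_apply', star_apply, star_apply, mul_apply]
  congr 2
  ext a
  rw [act_apply, adj_apply, actRight_apply, star_apply, star_star]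
  congr 1
  ext b
  simp

/-- Write f as a vector functional with ‖η‖ ≤ 1 on the GNS space of a dominating g. Then |F(f)|² ≤
‖`lift Λ F`‖² = (F⋆F)(g) ≤ ‖F⋆F‖‖f‖², the last step using ‖g‖ ≤ ‖f‖². -/
protected theorem norm_mul_self_le (F : SecondConj A) : ‖F‖ * ‖F‖ ≤ ‖star F * F‖ := by
  rw [← sq, ← Real.le_sqrt (norm_nonneg F) (norm_nonneg _)]
  refine norm_le (Real.sqrt_nonneg _) fun f => ?_
  obtain ⟨g, hgn, hg⟩ := exists_positive_dominating f
  obtain ⟨H, _, _, _, Λ, hd, hΛ⟩ := exists_gns g fun a =>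
    le_trans (by exact_mod_cast sq_nonneg ‖f a‖) (hg a)
  obtain ⟨η, hη, hf⟩ := exists_vector_of_dominated Λ hd f zero_le_one fun a => by
    have h := hg a
    rw [← hΛ, inner_self_eq_norm_sq_to_K] at h
    have h' : ‖f a‖ ^ 2 ≤ ‖Λ a‖ ^ 2 := Complex.real_le_real.1 (by simpa using h)
    rw [one_mul]
    exact (sq_le_sq₀ (norm_nonneg _) (norm_nonneg _)).1 h'
  have h1 : ‖F f‖ ≤ ‖lift Λ F‖ := by
    rw [hf, ← inner_lift]
    refine (norm_inner_le_norm _ _).trans ?_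
    exact mul_le_of_le_one_left (norm_nonneg _) hη
  have h2 : ‖lift Λ F‖ ^ 2 ≤ ‖star F * F‖ * ‖f‖ ^ 2 := by
    have h := star_mul_apply_eq_inner hΛ F F
    calc ‖lift Λ F‖ ^ 2 = ‖(star F * F) g‖ := by
          rw [h, inner_self_eq_norm_sq_to_K]; simp
      _ ≤ ‖star F * F‖ * ‖g‖ := norm_apply_le _ _
      _ ≤ _ := mul_le_mul_of_nonneg_left hgn (norm_nonneg _)
  calc ‖F f‖ ≤ ‖lift Λ F‖ := h1
    _ = Real.sqrt (‖lift Λ F‖ ^ 2) := (Real.sqrt_sq (norm_nonneg _)).symm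
    _ ≤ Real.sqrt (‖star F * F‖ * ‖f‖ ^ 2) := Real.sqrt_le_sqrt h2
    _ = _ := by rw [Real.sqrt_mul (norm_nonneg _), Real.sqrt_sq (norm_nonneg _)]

theorem norm_ι (a : A) : ‖(ι a : SecondConj A)‖ = ‖a‖ :=
  (NormedSpace.inclusionInDoubleDualLi ℂ).norm_map a

-- A weak⋆ cluster point of an approximate unit of A acts trivially on A* from both sides, the
-- second side by Arens regularity.
variable (A) in
theorem exists_unit : ∃ e : SecondConj A, (∀ F, F * e = F) ∧ ∀ F, e * F = F := by
  let _ : PartialOrder A := CStarAlgebra.spectralOrder A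
  have _ : StarOrderedRing A := CStarAlgebra.spectralOrderedRing A
  have hl := CStarAlgebra.increasingApproximateUnit A
  let U : Ultrafilter A := Ultrafilter.of (CStarAlgebra.approximateUnit A)
  have hU : (U : Filter A) ≤ CStarAlgebra.approximateUnit A := Ultrafilter.of_le _
  obtain ⟨e, he⟩ := exists_weak_limit U (fun a : A => (ι a : SecondConj A)) (C := 1)
    ((hl.eventually_norm.filter_mono hU).mono fun a ha => by rwa [norm_ι])
  simp only [ι_apply] at he
  refine ⟨e, fun F => ?_, fun F => ?_⟩ <;> ext f
  · have : act e f = f := by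
      ext a
      rw [act_apply]
      refine tendsto_nhds_unique (he _) ?_
      exact (f.continuous.tendsto a).comp ((hl.tendsto_mul_left a).mono_left hU)
    rw [mul_apply, this]
  · have : actRight e f = f := by
      ext a
      rw [actRight_apply]
      refine tendsto_nhds_unique (he _) ?_
      exact (f.continuous.tendsto a).comp ((hl.tendsto_mul_right a).mono_left hU)
    rw [mul_apply', this]

instance : Ring (SecondConj A) :=
  { (inferInstance : AddCommGroup (SecondConj A)), (inferInstance : Mul (SecondConj A)) with
    one := (exists_unit A).choose
    one_mul := (exists_unit A).choose_spec.2
    mul_one := (exists_unit A).choose_spec.1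
    mul_assoc := SecondConj.mul_assoc
    left_distrib := fun F G K => by
      ext f
      simp only [mul_apply', add_apply]
    right_distrib := fun F G K => by
      ext f
      simp only [mul_apply, add_apply]
    zero_mul := fun F => by
      ext f
      rw [mul_apply]; rfl
    mul_zero := fun F => by
      ext f
      rw [mul_apply']; rfl }

instance : NormedRing (SecondConj A) :=
  { (inferInstance : Ring (SecondConj A)),
    (inferInstance : NormedAddCommGroup (SecondConj A)) with
    norm_mul_le := SecondConj.norm_mul_le }

instance : NormedAlgebra ℂ (SecondConj A) :=
  { (inferInstance : NormedSpace ℂ (SecondConj A)),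
    Algebra.ofModule (R := ℂ) (A := SecondConj A)
      (fun c F G => by ext f; simp only [mul_apply, smul_apply])
      (fun c F G => by ext f; simp only [mul_apply', smul_apply]) with
    norm_smul_le := norm_smul_le }

instance : StarRing (SecondConj A) where
  star_involutive := SecondConj.star_star
  star_mul := SecondConj.star_mul
  star_add F G := by
    ext f
    simp only [star_apply, add_apply, star_add]

instance : CStarAlgebra (SecondConj A) where
  toCompleteSpace := (inferInstance : CompleteSpace (StrongDual ℂ (StrongDual ℂ A)))
  norm_mul_self_le := SecondConj.norm_mul_self_le
  star_smul c F := by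
    ext f
    simp only [star_apply, smul_apply, star_mul']

end Algebra

end SecondConj

namespace SecondConj

variable {A : Type*} [NonUnitalCStarAlgebra A]

/-! ### Left kernels of positive functionals -/

section PositiveFunctional

variable {ρ : StrongDual ℂ A} (hρ : ∀ a, 0 ≤ ρ (star a * a))
include hρ

theorem apply_star_mul_self_nonneg (F : SecondConj A) : 0 ≤ (star F * F) ρ := by
  obtain ⟨H, _, _, _, Λ, -, hΛ⟩ := exists_gns ρ hρ
  rw [star_mul_apply_eq_inner hΛ, inner_self_eq_norm_sq_to_K]
  simp only [Complex.coe_algebraMap]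
  exact_mod_cast sq_nonneg ‖lift Λ F‖

/-- The Cauchy–Schwarz inequality for the normal extension of a positive functional. -/
theorem norm_star_mul_apply_sq_le (F G : SecondConj A) :
    ‖(star F * G) ρ‖ ^ 2 ≤ ‖(star F * F) ρ‖ * ‖(star G * G) ρ‖ := by
  obtain ⟨H, _, _, _, Λ, -, hΛ⟩ := exists_gns ρ hρ
  simp only [star_mul_apply_eq_inner hΛ]
  calc ‖inner ℂ (lift Λ F) (lift Λ G)‖ ^ 2 ≤ (‖lift Λ F‖ * ‖lift Λ G‖) ^ 2 := by
        gcongr; exact norm_inner_le_norm _ _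
    _ = _ := by simp only [inner_self_eq_norm_sq_to_K]; simp [mul_pow]

theorem mul_apply_eq_zero {F : SecondConj A} (hF : (star F * F) ρ = 0) (G : SecondConj A) :
    (G * F) ρ = 0 := by
  have h := norm_star_mul_apply_sq_le hρ (star G) F
  rw [hF, norm_zero, mul_zero, star_star] at h
  exact norm_eq_zero.1 (pow_eq_zero_iff two_ne_zero |>.1 (le_antisymm h (sq_nonneg _)))

omit hρ in
theorem continuous_apply (f : StrongDual ℂ A) : Continuous fun F : SecondConj A => F f :=
  (ContinuousLinearMap.apply ℂ ℂ f).continuous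

/-- The hereditary subalgebra of `A**` on which the normal extension of a positive functional
vanishes. -/
def nullSubalgebra : NonUnitalStarSubalgebra ℂ (SecondConj A) where
  carrier := {F | (star F * F) ρ = 0 ∧ (F * star F) ρ = 0}
  add_mem' := by
    have key : ∀ {F G : SecondConj A}, (star F * F) ρ = 0 → (star G * G) ρ = 0 →
        (star (F + G) * (F + G)) ρ = 0 := fun {F G} hF hG => by
      rw [mul_add, add_apply, mul_apply_eq_zero hρ hF, mul_apply_eq_zero hρ hG, add_zero]
    rintro F G ⟨hF, hF'⟩ ⟨hG, hG'⟩
    refine ⟨key hF hG, ?_⟩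
    have := key (F := star F) (G := star G) (by rwa [star_star]) (by rwa [star_star])
    rwa [← star_add, star_star] at this
  zero_mem' := by
    simp only [Set.mem_ofPred_eq, mul_zero, zero_mul]
    exact ⟨rfl, rfl⟩
  mul_mem' := by
    rintro F G ⟨hF, hF'⟩ ⟨hG, hG'⟩
    refine ⟨?_, ?_⟩
    · rw [← mul_assoc]; exact mul_apply_eq_zero hρ hG _
    · rw [star_mul, ← mul_assoc]
      exact mul_apply_eq_zero hρ (by rwa [star_star]) _
  smul_mem' := by
    rintro c F ⟨hF, hF'⟩
    refine ⟨?_, ?_⟩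
    · rw [mul_smul_comm, smul_apply, mul_apply_eq_zero hρ hF, mul_zero]
    · rw [smul_mul_assoc, smul_apply, star_smul, mul_smul_comm, smul_apply, hF', mul_zero,
        mul_zero]
  star_mem' := by
    rintro F ⟨hF, hF'⟩
    exact ⟨by rwa [star_star], by rwa [star_star]⟩

theorem mem_nullSubalgebra {F : SecondConj A} :
    F ∈ nullSubalgebra hρ ↔ (star F * F) ρ = 0 ∧ (F * star F) ρ = 0 := Iff.rfl

theorem isClosed_nullSubalgebra : IsClosed (nullSubalgebra hρ : Set (SecondConj A)) :=
  (isClosed_eq ((continuous_apply ρ).comp (continuous_star.mul continuous_id))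
    continuous_const).inter
  (isClosed_eq ((continuous_apply ρ).comp (continuous_id.mul continuous_star)) continuous_const)

/-- The left kernel of the normal extension of a positive functional is cut out by a
projection. -/
theorem exists_projection_of_null : ∃ p : SecondConj A, IsStarProjection p ∧
    (star (1 - p) * (1 - p)) ρ = 0 ∧ ∀ F : SecondConj A, (star F * F) ρ = 0 → F * p = 0 := by
  let B := nullSubalgebra hρ
  have _ : IsClosed (B : Set (SecondConj A)) := isClosed_nullSubalgebra hρ
  let _ : PartialOrder B := CStarAlgebra.spectralOrder B
  have _ : StarOrderedRing B := CStarAlgebra.spectralOrderedRing B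
  have hl := CStarAlgebra.increasingApproximateUnit B
  let U : Ultrafilter B := Ultrafilter.of (CStarAlgebra.approximateUnit B)
  have hU : (U : Filter B) ≤ CStarAlgebra.approximateUnit B := Ultrafilter.of_le _
  -- The weak⋆ limit q of an approximate unit of N ∩ N⋆ is a projection with ρ̄(q) = 0 and is a
  -- right unit for N ∩ N⋆; the required projection is 1 - q.
  obtain ⟨q, hq⟩ := exists_weak_limit U (fun F : B => (F : SecondConj A)) (C := 1)
    (hl.eventually_norm.filter_mono hU)
  have mul_q : ∀ F ∈ B, F * q = F := fun F hF => by
    ext f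
    refine tendsto_nhds_unique (tendsto_mul_left hq F f) ?_
    have h1 : Tendsto (fun G : B => (⟨F, hF⟩ : B) * G) U (𝓝 ⟨F, hF⟩) :=
      (hl.tendsto_mul_left _).mono_left hU
    exact ((continuous_apply f).tendsto F).comp ((continuous_subtype_val.tendsto _).comp h1)
  have q_star : star q = q := by
    ext f
    refine tendsto_nhds_unique (tendsto_star hq f) ((hq f).congr' ?_)
    filter_upwards [hl.eventually_star_eq.filter_mono hU] with F hF
    conv_lhs => rw [← hF]
    rfl
  have q_mul : q * q = q := by
    ext f
    refine tendsto_nhds_unique (tendsto_mul_right hq q f) ((hq f).congr fun F => ?_)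
    rw [mul_q F F.2]
  have q_null : q ρ = 0 := by
    refine tendsto_nhds_unique (hq ρ) (tendsto_const_nhds.congr fun F => ?_)
    have := mul_apply_eq_zero hρ F.2.1 1
    rw [one_mul] at this
    exact this.symm
  refine ⟨1 - q, (IsStarProjection.mk q_mul q_star).one_sub, ?_, fun F hF => ?_⟩
  · rw [sub_sub_cancel, q_star, q_mul, q_null]
  · have h1 : star F * F ∈ B := by
      rw [mem_nullSubalgebra, star_mul, star_star, ← mul_assoc]
      exact ⟨mul_apply_eq_zero hρ hF _, mul_apply_eq_zero hρ hF _⟩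
    have h2 : star F * F * (1 - q) = 0 := by rw [mul_sub, mul_one, mul_q _ h1, sub_self]
    rw [← CStarRing.star_mul_self_eq_zero_iff, star_mul, mul_assoc, ← mul_assoc (star F), h2,
      mul_zero]

end PositiveFunctional

/-! ### Support projections of states -/

section State

variable {ρ : StrongDual ℂ A}

/-- Cauchy–Schwarz against 1 gives |ρ(a)|² ≤ ρ̄(1)‖a‖², hence ρ̄(1) ≥ 1; the other inequality
follows from ‖1‖ ≤ 1. -/
theorem one_apply_of_isState (hρ : IsState ρ) : (1 : SecondConj A) ρ = 1 := by
  have h0 : 0 ≤ (1 : SecondConj A) ρ := by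
    simpa using apply_star_mul_self_nonneg hρ.nonneg 1
  have h1 : ‖(1 : SecondConj A) ρ‖ ≤ 1 := by
    have h2 : ‖(1 : SecondConj A)‖ ≤ 1 := by
      have := CStarRing.norm_star_mul_self (x := (1 : SecondConj A))
      rw [star_one, one_mul] at this
      nlinarith [norm_nonneg (1 : SecondConj A)]
    simpa [hρ.norm_eq_one] using (norm_apply_le 1 ρ).trans
      (mul_le_mul_of_nonneg_right h2 (norm_nonneg ρ))
  have h2 : 1 ≤ ‖(1 : SecondConj A) ρ‖ := by
    have h3 : ‖ρ‖ ≤ Real.sqrt ‖(1 : SecondConj A) ρ‖ := by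
      refine ContinuousLinearMap.opNorm_le_bound _ (Real.sqrt_nonneg _) fun a => ?_
      refine le_of_sq_le_sq ?_ (by positivity)
      rw [mul_pow, Real.sq_sqrt (norm_nonneg _)]
      have h4 := norm_star_mul_apply_sq_le hρ.nonneg 1 (ι a)
      rw [star_one, one_mul, one_mul, ι_apply, ← ι_star, ← ι_mul, ι_apply] at h4
      refine h4.trans (mul_le_mul_of_nonneg_left ?_ (norm_nonneg _))
      refine (ρ.le_opNorm _).trans ?_
      rw [hρ.norm_eq_one, one_mul, CStarRing.norm_star_mul_self, sq]
    rw [hρ.norm_eq_one, Real.one_le_sqrt] at h3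
    exact h3
  have h3 : ‖(1 : SecondConj A) ρ‖ = 1 := le_antisymm h1 h2
  rw [← Complex.norm_of_nonneg' h0, h3]; simp

/-- Support projections exist, and annihilate the left kernel of the state. -/
theorem exists_isSupportProjection (hρ : IsState ρ) : ∃ p : SecondConj A,
    IsSupportProjection ρ p ∧ (star (1 - p) * (1 - p)) ρ = 0 ∧
      ∀ F : SecondConj A, (star F * F) ρ = 0 → F * p = 0 := by
  obtain ⟨p, hp, hp1, hnull⟩ := exists_projection_of_null hρ.nonneg
  have star_p : star p = p := hp.isSelfAdjoint
  refine ⟨p, ⟨hp, ?_, fun q hq hq1 => ?_⟩, hp1, hnull⟩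
  · have := mul_apply_eq_zero hρ.nonneg hp1 1
    rw [one_mul, sub_apply, one_apply_of_isState hρ, sub_eq_zero] at this
    exact this.symm
  · have hq' := hq.one_sub
    have h1 : star (1 - q) * (1 - q) = 1 - q := by
      rw [hq'.isSelfAdjoint.star_eq]; exact hq'.isIdempotentElem
    have h2 := hnull (1 - q) (by
      rw [h1, sub_apply, one_apply_of_isState hρ]
      exact sub_eq_zero.2 hq1.symm)
    rw [sub_mul, one_mul, sub_eq_zero] at h2
    have h3 := congrArg star h2
    rw [star_mul, star_p, hq.isSelfAdjoint.star_eq] at h3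
    exact h3.symm

theorem IsSupportProjection.eq {p q : SecondConj A} (hp : IsSupportProjection ρ p)
    (hq : IsSupportProjection ρ q) : p = q := by
  have h1 := hp.le_of_normalExt_eq_one q hq.isStarProjection hq.normalExt_eq_one
  have h2 := congrArg star
    (hq.le_of_normalExt_eq_one p hp.isStarProjection hp.normalExt_eq_one)
  rw [star_mul, hp.isStarProjection.isSelfAdjoint.star_eq,
    hq.isStarProjection.isSelfAdjoint.star_eq, h1] at h2
  exact h2

/-- If the left kernel of a state is a right ideal, then its support projection is central. -/
theorem exists_central_isSupportProjection (hρ : IsState ρ)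
    (h : ∀ F G : SecondConj A, (star F * F) ρ = 0 → (star (F * G) * (F * G)) ρ = 0) :
    ∃ p : SecondConj A, IsSupportProjection ρ p ∧ ∀ x, p * x = x * p := by
  obtain ⟨p, hp, hp1, hnull⟩ := exists_isSupportProjection hρ
  -- 1 - p lies in the left kernel, hence so does (1 - p)x, and p annihilates it on the right. The
  -- adjoint relation for x⋆ gives px = pxp.
  have key : ∀ x : SecondConj A, x * p = p * x * p := fun x => by
    have := hnull _ (h (1 - p) x hp1)
    rwa [sub_mul, sub_mul, one_mul, sub_eq_zero] at this
  refine ⟨p, hp, fun x => ?_⟩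
  have h1 := congrArg star (key (star x))
  have star_p : star p = p := hp.isStarProjection.isSelfAdjoint
  simp only [star_mul, star_star, star_p] at h1
  rw [h1, ← mul_assoc, ← key]

/-- The absolute continuity behind the stability of the left kernel at a central support. -/
theorem tendsto_conjugate_of_central (hρ : IsState ρ) {I : Type*} (U : Ultrafilter I)
    {p : SecondConj A} (hp : IsSupportProjection ρ p) (hc : ∀ x, p * x = x * p)
    (b : SecondConj A) {a : I → SecondConj A} {C : ℝ} (hC : ∀ i, ‖a i‖ ≤ C)
    (ha : Tendsto (fun i => (star (a i) * a i) ρ) U (𝓝 0)) :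
    Tendsto (fun i => (star b * star (a i) * a i * b) ρ) U (𝓝 0) := by
  obtain ⟨p', hp', hp1, hnull⟩ := exists_isSupportProjection hρ
  obtain rfl := hp.eq hp'
  have norm_le_sq : ∀ i, ‖star (a i) * a i‖ ≤ C ^ 2 := fun i => by
    rw [CStarRing.norm_star_mul_self, ← sq]
    exact pow_le_pow_left₀ (norm_nonneg _) (hC i) 2
  obtain ⟨x, hx⟩ := exists_weak_limit U (fun i => star (a i) * a i) (C := C ^ 2)
    (Eventually.of_forall norm_le_sq)
  have hxc : ∀ c : SecondConj A, (star c * x) ρ = 0 := fun c => by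
    refine tendsto_nhds_unique (tendsto_mul_left hx (star c) ρ) ?_
    have hbound : ∀ i, ‖(star c * (star (a i) * a i)) ρ‖ ^ 2 ≤
        ‖star c‖ * C ^ 2 * ‖c‖ * ‖(star (a i) * a i) ρ‖ := fun i => by
      -- Splitting c⋆aᵢ⋆aᵢ as (aᵢc)⋆aᵢ leaves the factor ρ̄(aᵢ⋆aᵢ), which tends to 0, times a
      -- bounded one.
      have h1 := norm_star_mul_apply_sq_le hρ.nonneg (a i * c) (a i)
      rw [star_mul, mul_assoc] at h1
      refine h1.trans (mul_le_mul_of_nonneg_right ?_ (norm_nonneg _))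
      refine (norm_apply_le _ _).trans ?_
      rw [hρ.norm_eq_one, mul_one, mul_assoc, ← mul_assoc (star (a i)), ← mul_assoc]
      refine (norm_mul_le _ _).trans (mul_le_mul_of_nonneg_right ?_ (norm_nonneg _))
      exact (norm_mul_le _ _).trans (mul_le_mul_of_nonneg_left (norm_le_sq i) (norm_nonneg _))
    have h2 : Tendsto (fun i => ‖(star c * (star (a i) * a i)) ρ‖ ^ 2) U (𝓝 0) := by
      refine squeeze_zero (fun i => by positivity) hbound ?_
      simpa using (ha.norm.const_mul (‖star c‖ * C ^ 2 * ‖c‖))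
    have h3 := h2.sqrt
    simp only [Real.sqrt_sq (norm_nonneg _), Real.sqrt_zero] at h3
    exact tendsto_zero_iff_norm_tendsto_zero.2 h3
  -- The choice c = x puts x in the left kernel.
  have hxp : x * p = 0 := hnull x (hxc x)
  have h1 := tendsto_mul_right (tendsto_mul_left hx (star b)) b ρ
  have h2 : (star b * x * b) ρ = 0 := by
    have h3 := mul_apply_eq_zero hρ.nonneg hp1 (star b * x * b)
    have h4 : x * b * p = 0 := by rw [mul_assoc, ← hc, ← mul_assoc, hxp, zero_mul]
    rw [mul_sub, mul_one, mul_assoc (star b), mul_assoc (star b), h4, mul_zero, sub_zero] at h3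
    rwa [mul_assoc]
  rw [h2] at h1
  simpa only [mul_assoc] using h1

end State

end SecondConj

/-! ### The left ideal L_ρ and the normalizer of D_ρ -/

section LeftIdeal

variable {A : Type*} [NonUnitalCStarAlgebra A] {H : Type*} [NormedAddCommGroup H]
  [InnerProductSpace ℂ H] {ρ : StrongDual ℂ A} {Λ : A →L[ℂ] H}

/-- Moving c across the inner product leaves one factor ‖Λ(a)‖, enough for bounded sequences without
a representation of A on H. -/
theorem norm_gns_mul_sq_le (hΛ : ∀ a b, inner ℂ (Λ a) (Λ b) = ρ (star a * b)) (c a : A) :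
    ‖Λ (c * a)‖ ^ 2 ≤ ‖Λ a‖ * (‖Λ‖ * (‖c‖ ^ 2 * ‖a‖)) := by
  have h1 : inner ℂ (Λ (c * a)) (Λ (c * a)) = inner ℂ (Λ a) (Λ (star c * c * a)) := by
    rw [hΛ, hΛ, star_mul]; simp only [mul_assoc]
  have h2 : ‖Λ (c * a)‖ ^ 2 = ‖inner ℂ (Λ (c * a)) (Λ (c * a))‖ := by
    rw [inner_self_eq_norm_sq_to_K]; simp
  rw [h2, h1]
  refine (norm_inner_le_norm _ _).trans (mul_le_mul_of_nonneg_left ?_ (norm_nonneg _))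
  refine (Λ.le_opNorm _).trans (mul_le_mul_of_nonneg_left ?_ (norm_nonneg _))
  refine (norm_mul_le _ _).trans ?_
  rw [CStarRing.norm_star_mul_self, sq]

variable {ω : Ultrafilter ℕ}

theorem mem_leftIdealL_iff (hΛ : ∀ a b, inner ℂ (Λ a) (Λ b) = ρ (star a * b)) {a : EllInfty A} :
    a ∈ leftIdealL ω ρ ↔ Tendsto (fun n => Λ (a n)) ω (𝓝 0) := by
  have h : ∀ n, ‖ρ (star (a n) * a n)‖ = ‖Λ (a n)‖ ^ 2 := fun n => by
    rw [← hΛ, inner_self_eq_norm_sq_to_K]; simp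
  change Tendsto (fun n => ρ (star (a n) * a n)) ω (𝓝 0) ↔ _
  rw [tendsto_zero_iff_norm_tendsto_zero, tendsto_zero_iff_norm_tendsto_zero (f := fun n => Λ _)]
  simp only [h]
  refine ⟨fun h => ?_, fun h => by simpa using h.pow 2⟩
  simpa [Real.sqrt_sq] using h.sqrt

theorem mul_mem_leftIdealL (hΛ : ∀ a b, inner ℂ (Λ a) (Λ b) = ρ (star a * b)) (c : EllInfty A)
    {a : EllInfty A} (ha : a ∈ leftIdealL ω ρ) : c * a ∈ leftIdealL ω ρ := by
  rw [mem_leftIdealL_iff hΛ] at ha ⊢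
  have hbound : ∀ n, ‖Λ ((c * a) n)‖ ^ 2 ≤ ‖Λ (a n)‖ * (‖Λ‖ * (‖c‖ ^ 2 * ‖a‖)) := fun n => by
    refine (norm_gns_mul_sq_le hΛ (c n) (a n)).trans ?_
    have h1 := lp.norm_apply_le_norm ENNReal.top_ne_zero c n
    have h2 := lp.norm_apply_le_norm ENNReal.top_ne_zero a n
    gcongr
  have h : Tendsto (fun n => ‖Λ ((c * a) n)‖ ^ 2) ω (𝓝 0) := by
    refine squeeze_zero (fun n => by positivity) hbound ?_
    simpa using ha.norm.mul_const (‖Λ‖ * (‖c‖ ^ 2 * ‖a‖))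
  refine tendsto_zero_iff_norm_tendsto_zero.2 ?_
  simpa [Real.sqrt_sq] using h.sqrt

theorem add_mem_leftIdealL (hΛ : ∀ a b, inner ℂ (Λ a) (Λ b) = ρ (star a * b)) {a b : EllInfty A}
    (ha : a ∈ leftIdealL ω ρ) (hb : b ∈ leftIdealL ω ρ) : a + b ∈ leftIdealL ω ρ := by
  rw [mem_leftIdealL_iff hΛ] at ha hb ⊢
  simpa using ha.add hb

theorem star_diag (b : A) : star (diag b) = diag (star b) := rfl

theorem diag_mem_normalizerN (hΛ : ∀ a b, inner ℂ (Λ a) (Λ b) = ρ (star a * b))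
    (h : ∀ b : A, ∀ a ∈ leftIdealL ω ρ, a * diag b ∈ leftIdealL ω ρ) (b : A) :
    diag b ∈ normalizerN (hereditaryD ω ρ) := by
  rintro d ⟨hd, hd'⟩ e ⟨he, he'⟩
  refine ⟨add_mem_leftIdealL hΛ (mul_mem_leftIdealL hΛ _ hd) (h b e he), ?_⟩
  rw [star_add, star_mul, star_mul, star_diag]
  exact add_mem_leftIdealL hΛ (h _ _ hd') (mul_mem_leftIdealL hΛ _ he')

theorem mul_diag_mem_of_normalizer (hΛ : ∀ a b, inner ℂ (Λ a) (Λ b) = ρ (star a * b))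
    (h : Set.range (diag : A → EllInfty A) ⊆ normalizerN (hereditaryD ω ρ)) (b : A)
    {a : EllInfty A} (ha : a ∈ leftIdealL ω ρ) : a * diag b ∈ leftIdealL ω ρ := by
  have hD : star a * a ∈ hereditaryD ω ρ := by
    have := mul_mem_leftIdealL hΛ (star a) ha
    refine ⟨this, ?_⟩
    rwa [star_mul, star_star]
  have h0 : (0 : EllInfty A) ∈ hereditaryD ω ρ := by
    have : (0 : EllInfty A) ∈ leftIdealL ω ρ := by
      rw [mem_leftIdealL_iff hΛ]
      simp
    exact ⟨this, by rwa [star_zero]⟩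
  -- Taking d = 0 isolates the summand a⋆aΔ(b).
  have h1 := (h ⟨b, rfl⟩ 0 h0 _ hD).1
  rw [mul_zero, zero_add, mem_leftIdealL_iff hΛ] at h1
  have h2 : Tendsto (fun n => inner ℂ (Λ b) (Λ ((star a * a * diag b) n))) ω (𝓝 0) := by
    simpa using (tendsto_const_nhds (x := Λ b)).inner h1
  refine h2.congr fun n => ?_
  rw [hΛ]
  simp only [lp.infty_coeFn_mul, lp.coeFn_star, Pi.mul_apply, Pi.star_apply, diag_apply, star_mul,
    mul_assoc]

end LeftIdeal

/-! ### From sequences in A to the left kernel in A** -/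

namespace SecondConj

variable {A : Type*} [NonUnitalCStarAlgebra A] {ρ : StrongDual ℂ A} {ω : Ultrafilter ℕ}

/-- The stability of `L_ρ` passes to the left kernel of the normal extension, by approximation
of elements of `A**` by bounded sequences in `A`. -/
theorem null_mul_ι (hω : (ω : Filter ℕ) ≤ cofinite) (hρ : ∀ a, 0 ≤ ρ (star a * a))
    (h : ∀ b : A, ∀ a ∈ leftIdealL ω ρ, a * diag b ∈ leftIdealL ω ρ)
    {F : SecondConj A} (hF : (star F * F) ρ = 0) (b : A) :
    (star (F * ι b) * (F * ι b)) ρ = 0 := by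
  obtain ⟨H, _, _, _, Λ, -, hΛ⟩ := exists_gns ρ hρ
  let S : A →L[ℂ] H := Λ.comp ((ContinuousLinearMap.mul ℂ A).flip b)
  have hFΛ : lift Λ F = 0 := by
    rwa [star_mul_apply_eq_inner hΛ, inner_self_eq_zero] at hF
  have hS : lift Λ (F * ι b) = lift S F := by
    refine ext_inner_left ℂ fun η => ?_
    rw [inner_lift, inner_lift, mul_apply]
    rfl
  obtain ⟨v, hv, hlim⟩ := mem_closure_iff_seq_limit.1 (lift_prod_mem_closure Λ S F)
  choose a ha hav using hv
  have hbdd : Memℓp a ∞ := memℓp_infty ⟨‖F‖, by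
    rintro _ ⟨n, rfl⟩
    exact mem_closedBall_zero_iff.1 (ha n)⟩
  -- Freeness of ω turns the ordinary limit of the approximating sequence into a limit along ω.
  have hω' : (ω : Filter ℕ) ≤ atTop := by rwa [← Nat.cofinite_eq_atTop]
  have hlim' : Tendsto (fun n => (Λ (a n), S (a n))) ω (𝓝 (lift Λ F, lift S F)) := by
    refine (hlim.mono_left hω').congr fun n => ?_
    rw [← hav n]; rfl
  have h1 : Tendsto (fun n => Λ (a n)) ω (𝓝 0) := by
    rw [← hFΛ]
    exact (continuous_fst.tendsto _).comp hlim'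
  have h2 := h b ⟨a, hbdd⟩ ((mem_leftIdealL_iff hΛ).2 h1)
  rw [mem_leftIdealL_iff hΛ] at h2
  have h3 : lift S F = 0 :=
    tendsto_nhds_unique ((continuous_snd.tendsto _).comp hlim') h2
  rw [star_mul_apply_eq_inner hΛ, hS, h3, inner_zero_left]

/-- With the left factor (FG)⋆F frozen, the value is normal in the remaining G, and it vanishes for
G in A by `null_mul_ι`. -/
theorem null_mul (hω : (ω : Filter ℕ) ≤ cofinite) (hρ : ∀ a, 0 ≤ ρ (star a * a))
    (h : ∀ b : A, ∀ a ∈ leftIdealL ω ρ, a * diag b ∈ leftIdealL ω ρ)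
    (F G : SecondConj A) (hF : (star F * F) ρ = 0) : (star (F * G) * (F * G)) ρ = 0 := by
  have h1 : actRight (star (F * G) * F) ρ = 0 := by
    ext b
    rw [← mul_ι_apply, mul_assoc]
    exact mul_apply_eq_zero hρ (null_mul_ι hω hρ h hF b) _
  rw [← mul_assoc, mul_apply', h1]
  exact ContinuousLinearMap.map_zero (G : StrongDual ℂ (StrongDual ℂ A))

end SecondConj

end

/-- Let `ω` be a free ultrafilter on `ℕ` and `ρ` a state on a C⋆-algebra `A`. The five
conditions on the stability of `L_ρ` under right multiplication are equivalent. -/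
theorem proposition4p14 {A : Type*} [NonUnitalCStarAlgebra A]
    (ω : Ultrafilter ℕ) (hω : (ω : Filter ℕ) ≤ Filter.cofinite)
    (ρ : StrongDual ℂ A) (hρ : IsState ρ) :
    List.TFAE [
      ∀ b : A, ∀ a ∈ leftIdealL ω ρ, a * diag b ∈ leftIdealL ω ρ,
      Set.range (diag : A → EllInfty A) ⊆ normalizerN (hereditaryD ω ρ),
      ∀ b : A, ∀ a : EllInfty (SecondConj A),
        Tendsto (fun n => SecondConj.normalExt ρ (star (a n) * a n)) ω (𝓝 0) →
        Tendsto (fun n => SecondConj.normalExt ρ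
          (star (SecondConj.ι b) * star (a n) * a n * SecondConj.ι b)) ω (𝓝 0),
      ∀ b : SecondConj A, ∀ a : EllInfty (SecondConj A),
        Tendsto (fun n => SecondConj.normalExt ρ (star (a n) * a n)) ω (𝓝 0) →
        Tendsto (fun n => SecondConj.normalExt ρ (star b * star (a n) * a n * b)) ω (𝓝 0),
      ∃ p : SecondConj A, SecondConj.IsSupportProjection ρ p ∧
        ∀ x : SecondConj A, p * x = x * p] := by
  obtain ⟨H, _, _, _, Λ, -, hΛ⟩ := exists_gns ρ hρ.nonneg
  tfae_have 1 → 2 := by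
    rintro h _ ⟨b, rfl⟩
    exact diag_mem_normalizerN hΛ h b
  tfae_have 2 → 1 := fun h b a ha => mul_diag_mem_of_normalizer hΛ h b ha
  tfae_have 1 → 5 := fun h =>
    SecondConj.exists_central_isSupportProjection hρ (SecondConj.null_mul hω hρ.nonneg h)
  tfae_have 5 → 4 := by
    rintro ⟨p, hp, hc⟩ b a ha
    have hC : ∀ n, ‖a n‖ ≤ ‖a‖ := fun n => lp.norm_apply_le_norm ENNReal.top_ne_zero a n
    exact SecondConj.tendsto_conjugate_of_central hρ ω hp hc b (a := fun n => a n) hC ha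
  tfae_have 4 → 3 := fun h b a ha => h (SecondConj.ι b) a ha
  tfae_have 3 → 1 := by
    intro h b a ha
    have hbdd : Memℓp (fun n => (SecondConj.ι (a n) : SecondConj A)) ∞ := memℓp_infty ⟨‖a‖, by
      rintro _ ⟨n, rfl⟩
      change ‖SecondConj.ι (a n)‖ ≤ _
      rw [SecondConj.norm_ι]
      exact lp.norm_apply_le_norm ENNReal.top_ne_zero a n⟩
    let c : EllInfty (SecondConj A) := ⟨_, hbdd⟩
    have hc : ∀ n, c n = SecondConj.ι (a n) := fun _ => rfl
    have h1 : ∀ n, SecondConj.normalExt ρ (star (c n) * c n) = ρ (star (a n) * a n) := fun n => by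
      rw [hc, SecondConj.normalExt_apply, ← SecondConj.ι_star, ← SecondConj.ι_mul,
        SecondConj.ι_apply]
    have h2 : ∀ n, SecondConj.normalExt ρ
        (star (SecondConj.ι b) * star (c n) * c n * SecondConj.ι b) =
          ρ (star ((a * diag b) n) * (a * diag b) n) := fun n => by
      have e : (a * diag b) n = a n * b := rfl
      rw [hc, e, SecondConj.normalExt_apply, ← SecondConj.ι_star, ← SecondConj.ι_star,
        ← SecondConj.ι_mul, ← SecondConj.ι_mul, ← SecondConj.ι_mul, SecondConj.ι_apply, star_mul,
        mul_assoc (star b * star (a n))]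
    have h3 := h b c (Tendsto.congr (fun n => (h1 n).symm) ha)
    exact Tendsto.congr h2 h3
  tfae_finish
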